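/- Fix a set $S$; all spaces below have cardinality at most $\# S$. An almost Lorentzian pre-length space is a set $X$ with a function $\sigma : X \times X \to \mathbb{R}$ that is antisymmetric and satisfies $\sigma(x,z) \ge \sigma(x,y) + \sigma(y,z)$ whenever $\sigma(x,y), \sigma(y,z) > 0$; isomorphisms are the $\sigma$-preserving bijections, and ${\rm ALL}^I$ is the set of isomorphism classes. Fix any rule assigning to each such space a topology on its underlying set, and let ${\rm ALL}^I_{fd} \subset {\rm ALL}^I$ be the set of classes of those nonempty compact spaces for which $\sup_{x,y \in X} |\sigma(x,y)| < \infty$. For $f : \mathbb{R} \to \mathbb{R}$ let $\Phi_{f,\infty}$ map the class of $(X,\sigma)$ to the isometry class of the extended pseudometric space $(X, d_{f,\infty})$ with $$ d_{f,\infty}(x,y) = \sup_{z \in X} |f(\sigma(x,z)) - f(\sigma(y,z))| \in [0,\infty]. $$ Let $d^+_{GH}$ be the Gromov--Hausdorff distance between isometry classes of extended pseudometric spaces, $$ d^+_{GH}(A,B) = \tfrac12 \inf_R \, \sup \{ |d_A(a,a') - d_B(b,b')| : (a,b), (a',b') \in R \} \in [0,\infty], $$ where $R$ runs over the correspondences,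 i.e. the relations $R \subset A \times B$ that project onto both $A$ and $B$, and where $|\infty - \infty| := 0$. Put $(\Phi_{f,\infty}^* d^+_{GH})(X,Y) = d^+_{GH}(\Phi_{f,\infty}(X), \Phi_{f,\infty}(Y))$. Theorem. Let $f : \mathbb{R} \to \mathbb{R}$ be measurable and locally bounded. Then: (i) $\Phi_{f,\infty}^* d^+_{GH}$ is an extended pseudometric on ${\rm ALL}^I$. (ii) Its restriction to ${\rm ALL}^I_{fd}$ is a (finite) pseudometric. (iii) If $S$ is infinite, then $\Phi_{f,\infty}$ is not injective on ${\rm ALL}^I_{fd}$, and $\Phi_{f,\infty}^* d^+_{GH}$ is not a metric on ${\rm ALL}^I_{fd}$. This holds in particular for every diffeomorphism $f$ of $\mathbb{R}$. -/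

import Mathlib

open scoped ENNReal Topology

universe u v

namespace LorentzGH

/-- `f` is a locally bounded (Borel) measurable real function on the real line. -/
def LBM (f : ℝ → ℝ) : Prop :=
  Measurable f ∧ ∀ t : ℝ, ∃ U ∈ 𝓝 t, ∃ C : ℝ, ∀ s ∈ U, |f s| ≤ C

/-! ### Almost Lorentzian pre-length spaces -/

/-- An almost Lorentzian pre-length space of cardinality at most `#S`: a set with a signed
Lorentzian distance function. -/
structure ALL (S : Type u) where
  carrier : Type u
  card_le : Cardinal.mk carrier ≤ Cardinal.mk S
  σ : carrier → carrier → ℝ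
  antisymm : ∀ x y, σ x y = - σ y x
  reverse_triangle : ∀ x y z, 0 < σ x y → 0 < σ y z → σ x y + σ y z ≤ σ x z

variable {S : Type u}

/-- An isomorphism of almost Lorentzian pre-length spaces. -/
structure ALL.Iso (X Y : ALL S) extends X.carrier ≃ Y.carrier where
  map_σ : ∀ x y, Y.σ (toEquiv x) (toEquiv y) = X.σ x y

def ALL.isoSetoid (S : Type u) : Setoid (ALL S) where
  r X Y := Nonempty (ALL.Iso X Y)
  iseqv :=
    { refl := fun X => ⟨⟨Equiv.refl _, fun _ _ => rfl⟩⟩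
      symm := fun {X Y} ⟨e⟩ => ⟨⟨e.toEquiv.symm, fun x y => by
        rw [← e.map_σ]; simp⟩⟩
      trans := fun {X Y Z} ⟨e⟩ ⟨e'⟩ => ⟨⟨e.toEquiv.trans e'.toEquiv, fun x y => by
        simp only [Equiv.trans_apply]; rw [e'.map_σ, e.map_σ]⟩⟩ }

/-- The isomorphism classes of almost Lorentzian pre-length spaces. -/
def ALLI (S : Type u) : Type (u + 1) := Quotient (ALL.isoSetoid S)

/-- The isomorphism class of an almost Lorentzian pre-length space. -/
def ALL.toClass (X : ALL S) : ALLI S := Quotient.mk (ALL.isoSetoid S) X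

/-- The isomorphism classes of nonempty compact almost Lorentzian pre-length spaces whose
Lorentzian distance has a finite supremum. Compactness refers to the topologies `T`. -/
def ALLIfd (T : ∀ X : ALL S, TopologicalSpace X.carrier) : Set (ALLI S) :=
  ALL.toClass '' {X : ALL S | Nonempty X.carrier ∧ @CompactSpace X.carrier (T X) ∧
    ∃ C : ℝ, ∀ x y, |X.σ x y| ≤ C}

/-! ### The Gromov-Hausdorff distance -/

/-- A set of cardinality at most `#S` with an extended pseudometric. -/
structure EPM (S : Type u) where
  carrier : Type u
  card_le : Cardinal.mk carrier ≤ Cardinal.mk S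
  [inst : PseudoEMetricSpace carrier]

attribute [instance] EPM.inst

def EPM.isoSetoid (S : Type u) : Setoid (EPM S) where
  r A B := Nonempty (A.carrier ≃ᵢ B.carrier)
  iseqv :=
    { refl := fun _ => ⟨IsometryEquiv.refl _⟩
      symm := fun ⟨e⟩ => ⟨e.symm⟩
      trans := fun ⟨e⟩ ⟨e'⟩ => ⟨e.trans e'⟩ }

/-- The isometry classes of extended pseudometric spaces. -/
def EPMI (S : Type u) : Type (u + 1) := Quotient (EPM.isoSetoid S)

/-- The absolute difference of two elements of `[0, ∞]`, with `|∞ - ∞| = 0`. -/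
noncomputable def absDiff (a b : ℝ≥0∞) : ℝ≥0∞ := max (a - b) (b - a)

/-- `R` is a correspondence: both of its projections are surjective. -/
def IsCorrespondence {A B : Type u} (R : A → B → Prop) : Prop :=
  (∀ a, ∃ b, R a b) ∧ (∀ b, ∃ a, R a b)

/-- The distortion of a relation between two extended pseudometric spaces. -/
noncomputable def distortion {A B : Type u} [PseudoEMetricSpace A] [PseudoEMetricSpace B]
    (R : A → B → Prop) : ℝ≥0∞ :=
  ⨆ (a : A) (a' : A) (b : B) (b' : B) (_ : R a b) (_ : R a' b'),
    absDiff (edist a a') (edist b b')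

/-- The Gromov-Hausdorff distance: half the infimal distortion of a correspondence. -/
noncomputable def EPM.dGH (A B : EPM S) : ℝ≥0∞ :=
  (⨅ (R : A.carrier → B.carrier → Prop) (_ : IsCorrespondence R), distortion R) / 2

theorem EPM.dGH_le_of_iso {A A' B B' : EPM S} (e : A.carrier ≃ᵢ A'.carrier)
    (e' : B.carrier ≃ᵢ B'.carrier) : A'.dGH B' ≤ A.dGH B := by
  unfold EPM.dGH
  refine ENNReal.div_le_div_right (le_iInf fun R => le_iInf fun hR => ?_) 2
  refine iInf_le_of_le (fun a b => R (e.symm a) (e'.symm b)) (iInf_le_of_le ⟨fun a => ?_, fun b => ?_⟩ ?_)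
  · obtain ⟨b, hb⟩ := hR.1 (e.symm a)
    exact ⟨e' b, by simpa using hb⟩
  · obtain ⟨a, ha⟩ := hR.2 (e'.symm b)
    exact ⟨e a, by simpa using ha⟩
  · unfold distortion
    refine iSup_le fun a => iSup_le fun a' => iSup_le fun b => iSup_le fun b' =>
      iSup_le fun h => iSup_le fun h' => ?_
    refine le_iSup_of_le (e.symm a) (le_iSup_of_le (e.symm a') (le_iSup_of_le (e'.symm b)
      (le_iSup_of_le (e'.symm b') (le_iSup_of_le h (le_iSup_of_le h' ?_)))))
    rw [e.symm.isometry.edist_eq, e'.symm.isometry.edist_eq]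

/-- The Gromov-Hausdorff distance between isometry classes. -/
noncomputable def dGHPlus : EPMI S → EPMI S → ℝ≥0∞ :=
  Quotient.lift₂ (s₁ := EPM.isoSetoid S) (s₂ := EPM.isoSetoid S) EPM.dGH
    (fun _ _ _ _ ⟨e⟩ ⟨e'⟩ =>
      le_antisymm (EPM.dGH_le_of_iso e.symm e'.symm) (EPM.dGH_le_of_iso e e'))

/-! ### The map `Φ` and the pulled-back distance -/

/-- The extended pseudometric `d x y = sup_z |f (σ x z) - f (σ y z)|`. -/
noncomputable def ALL.dSup (f : ℝ → ℝ) (X : ALL S) (x y : X.carrier) : ℝ≥0∞ :=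
  ⨆ z : X.carrier, ENNReal.ofReal |f (X.σ x z) - f (X.σ y z)|

/-- The space `X` with the extended pseudometric `dSup f`. -/
noncomputable def ALL.Phi (f : ℝ → ℝ) (X : ALL S) : EPM S where
  carrier := X.carrier
  card_le := X.card_le
  inst :=
    { edist := X.dSup f
      edist_self := fun x => by simp [ALL.dSup]
      edist_comm := fun x y => by simp only [ALL.dSup, abs_sub_comm]
      edist_triangle := fun x y z => by
        refine iSup_le fun w => ?_
        refine le_trans ?_ (add_le_add
          (le_iSup (fun w => ENNReal.ofReal |f (X.σ x w) - f (X.σ y w)|) w)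
          (le_iSup (fun w => ENNReal.ofReal |f (X.σ y w) - f (X.σ z w)|) w))
        rw [← ENNReal.ofReal_add (abs_nonneg _) (abs_nonneg _)]
        exact ENNReal.ofReal_le_ofReal (abs_sub_le _ _ _) }

theorem ALL.Phi_iso (f : ℝ → ℝ) {X Y : ALL S} (e : ALL.Iso X Y) :
    Nonempty ((X.Phi f).carrier ≃ᵢ (Y.Phi f).carrier) := by
  refine ⟨⟨e.toEquiv, fun x y => ?_⟩⟩
  have key : ∀ x y : X.carrier, Y.dSup f (e.toEquiv x) (e.toEquiv y) = X.dSup f x y := by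
    intro x y
    unfold ALL.dSup
    rw [← e.toEquiv.iSup_comp]
    simp only [e.map_σ]
  exact key x y

/-- The map on classes induced by `ALL.Phi`. -/
noncomputable def PhiI (f : ℝ → ℝ) : ALLI S → EPMI S :=
  Quotient.map' (s₁ := ALL.isoSetoid S) (s₂ := EPM.isoSetoid S) (ALL.Phi f)
    (fun _ _ ⟨e⟩ => ALL.Phi_iso f e)

/-- The pull-back of the Gromov-Hausdorff distance by `PhiI f`. -/
noncomputable def pullbackGH (f : ℝ → ℝ) (X Y : ALLI S) : ℝ≥0∞ :=
  dGHPlus (PhiI f X) (PhiI f Y)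

/-! ### (Extended) (pseudo)metrics on a set -/

structure IsExtPseudometricOn {α : Type v} (A : Set α) (d : α → α → ℝ≥0∞) : Prop where
  self : ∀ x ∈ A, d x x = 0
  symm : ∀ x ∈ A, ∀ y ∈ A, d x y = d y x
  triangle : ∀ x ∈ A, ∀ y ∈ A, ∀ z ∈ A, d x z ≤ d x y + d y z

structure IsPseudometricOn {α : Type v} (A : Set α) (d : α → α → ℝ≥0∞) : Prop
    extends IsExtPseudometricOn A d where
  finite : ∀ x ∈ A, ∀ y ∈ A, d x y ≠ ∞

structure IsMetricOn {α : Type v} (A : Set α) (d : α → α → ℝ≥0∞) : Prop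
    extends IsPseudometricOn A d where
  eq_of_eq_zero : ∀ x ∈ A, ∀ y ∈ A, d x y = 0 → x = y

end LorentzGH

/-!
The Gromov-Hausdorff distance is an extended pseudometric because correspondences can be reversed
and composed, the distortion of a composition being at most the sum of the distortions
(`distortion_comp_le`). Pulling back along `PhiI f` preserves this. If `|σ|` is bounded on `X` and
on `Y`, then `f ∘ σ` is bounded on both spaces, since `f` is bounded on compact intervals, and the
full relation between two nonempty such spaces has finite distortion.

Non-injectivity comes from *bipartite* spaces: sources `P`, sinks `Q`, and an incidence relation
`M ⊆ P × Q`, where `σ p q = 1` if `M p q` holds, and all other pairs of a source and a sink, of two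
sources or of two sinks have `σ = 0`. No two consecutive values of `σ` are positive, so the reverse
triangle inequality is void. If `M` has nonempty, pairwise distinct rows and columns, the distance
`dSup f` no longer depends on `M` (`dSup_bipartite_congr`): distinct sources are at distance
`|f 1 - f 0|`, distinct sinks at distance `|f (-1) - f 0|`, and a source and a sink at the larger of
these two numbers. On two sources and two sinks both the identity matrix and the triangular matrix
satisfy this condition, but they have different numbers of nonzero entries, so the two spaces are
not isomorphic. They are finite, hence compact in whatever topology they carry.
-/

namespace LorentzGH

variable {S : Type u}

/-! ### Distortion and correspondences -/

theorem absDiff_self (a : ℝ≥0∞) : absDiff a a = 0 := by simp [absDiff]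

theorem absDiff_comm (a b : ℝ≥0∞) : absDiff a b = absDiff b a := max_comm _ _

theorem absDiff_triangle (a b c : ℝ≥0∞) : absDiff a c ≤ absDiff a b + absDiff b c := by
  refine max_le ?_ ?_
  · exact tsub_le_tsub_add_tsub.trans (add_le_add (le_max_left _ _) (le_max_left _ _))
  · rw [add_comm]
    exact tsub_le_tsub_add_tsub.trans (add_le_add (le_max_right _ _) (le_max_right _ _))

theorem absDiff_le_distortion {A B : Type u} [PseudoEMetricSpace A] [PseudoEMetricSpace B]
    {R : A → B → Prop} {a a' : A} {b b' : B} (h : R a b) (h' : R a' b') :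
    absDiff (edist a a') (edist b b') ≤ distortion R :=
  le_iSup_of_le a (le_iSup_of_le a' (le_iSup_of_le b
    (le_iSup_of_le b' (le_iSup_of_le h (le_iSup_of_le h' le_rfl)))))

theorem distortion_le {A B : Type u} [PseudoEMetricSpace A] [PseudoEMetricSpace B]
    {R : A → B → Prop} {c : ℝ≥0∞}
    (h : ∀ a a' b b', R a b → R a' b' → absDiff (edist a a') (edist b b') ≤ c) :
    distortion R ≤ c :=
  iSup_le fun a => iSup_le fun a' => iSup_le fun b => iSup_le fun b' =>
    iSup_le fun hab => iSup_le fun hab' => h a a' b b' hab hab'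

theorem distortion_comp_le {A B C : Type u} [PseudoEMetricSpace A] [PseudoEMetricSpace B]
    [PseudoEMetricSpace C] (R : A → B → Prop) (R' : B → C → Prop) :
    distortion (Relation.Comp R R') ≤ distortion R + distortion R' := by
  refine distortion_le ?_
  rintro a a' c c' ⟨b, hab, hbc⟩ ⟨b', hab', hbc'⟩
  exact (absDiff_triangle _ (edist b b') _).trans
    (add_le_add (absDiff_le_distortion hab hab') (absDiff_le_distortion hbc hbc'))

theorem IsCorrespondence.comp {A B C : Type u} {R : A → B → Prop} {R' : B → C → Prop}
    (h : IsCorrespondence R) (h' : IsCorrespondence R') :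
    IsCorrespondence (Relation.Comp R R') := by
  refine ⟨fun a => ?_, fun c => ?_⟩
  · obtain ⟨b, hb⟩ := h.1 a
    obtain ⟨c, hc⟩ := h'.1 b
    exact ⟨c, b, hb, hc⟩
  · obtain ⟨b, hb⟩ := h'.2 c
    obtain ⟨a, ha⟩ := h.2 b
    exact ⟨a, b, ha, hb⟩

/-! ### The Gromov-Hausdorff distance as an extended pseudometric -/

theorem EPM.dGH_le_of_correspondence {A B : EPM S} {R : A.carrier → B.carrier → Prop}
    (hR : IsCorrespondence R) : A.dGH B ≤ distortion R / 2 :=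
  ENNReal.div_le_div_right (iInf₂_le R hR) 2

theorem EPM.dGH_self (A : EPM S) : A.dGH A = 0 := by
  have hR : IsCorrespondence (fun a b : A.carrier => a = b) :=
    ⟨fun a => ⟨a, rfl⟩, fun a => ⟨a, rfl⟩⟩
  have h0 : distortion (fun a b : A.carrier => a = b) ≤ 0 :=
    distortion_le fun a a' b b' h h' => by
      subst h h'
      exact (absDiff_self _).le
  refine le_antisymm ((EPM.dGH_le_of_correspondence hR).trans ?_) zero_le
  simp [le_antisymm h0 zero_le]

theorem EPM.dGH_le_swap (A B : EPM S) : A.dGH B ≤ B.dGH A := by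
  refine ENNReal.div_le_div_right (le_iInf₂ fun R hR => ?_) 2
  refine (iInf₂_le (fun a b => R b a) ⟨hR.2, hR.1⟩).trans (distortion_le fun a a' b b' h h' => ?_)
  rw [absDiff_comm]
  exact absDiff_le_distortion h h'

theorem EPM.dGH_triangle (A B C : EPM S) : A.dGH C ≤ A.dGH B + B.dGH C := by
  unfold EPM.dGH
  rw [← ENNReal.add_div]
  refine ENNReal.div_le_div_right ?_ 2
  simp only [ENNReal.iInf_add, ENNReal.add_iInf]
  refine le_iInf₂ fun R' hR' => le_iInf₂ fun R hR => ?_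
  exact (iInf₂_le _ (hR.comp hR')).trans (distortion_comp_le R R')

theorem isExtPseudometricOn_pullbackGH (f : ℝ → ℝ) (A : Set (ALLI S)) :
    IsExtPseudometricOn A (pullbackGH f) where
  self := fun x _ => by
    induction x using Quotient.inductionOn
    exact EPM.dGH_self _
  symm := fun x _ y _ => by
    induction x using Quotient.inductionOn
    induction y using Quotient.inductionOn
    exact le_antisymm (EPM.dGH_le_swap _ _) (EPM.dGH_le_swap _ _)
  triangle := fun x _ y _ z _ => by
    induction x using Quotient.inductionOn
    induction y using Quotient.inductionOn
    induction z using Quotient.inductionOn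
    exact EPM.dGH_triangle _ _ _

/-! ### Finiteness on bounded spaces -/

theorem LBM.bounded_on_Icc {f : ℝ → ℝ} (hf : LBM f) (C : ℝ) :
    ∃ M : ℝ, ∀ t, |t| ≤ C → |f t| ≤ M := by
  have h : ∃ M : ℝ, ∀ t ∈ Set.Icc (-C) C, |f t| ≤ M := by
    refine isCompact_Icc.induction_on (p := fun s => ∃ M : ℝ, ∀ t ∈ s, |f t| ≤ M)
      ⟨0, by simp⟩ ?_ ?_ ?_
    · rintro s t hst ⟨M, hM⟩
      exact ⟨M, fun x hx => hM x (hst hx)⟩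
    · rintro s t ⟨M, hM⟩ ⟨N, hN⟩
      refine ⟨max M N, fun x hx => ?_⟩
      rcases hx with hx | hx
      · exact (hM x hx).trans (le_max_left _ _)
      · exact (hN x hx).trans (le_max_right _ _)
    · intro x _
      obtain ⟨U, hU, M, hM⟩ := hf.2 x
      exact ⟨U, mem_nhdsWithin_of_mem_nhds hU, M, hM⟩
  obtain ⟨M, hM⟩ := h
  exact ⟨M, fun t ht => hM t (abs_le.1 ht)⟩

theorem ALL.dSup_bounded {f : ℝ → ℝ} (hf : LBM f) (X : ALL S) {C : ℝ}
    (hC : ∀ x y, |X.σ x y| ≤ C) :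
    ∃ D : ℝ≥0∞, D ≠ ∞ ∧ ∀ x y, X.dSup f x y ≤ D := by
  obtain ⟨M, hM⟩ := hf.bounded_on_Icc C
  refine ⟨ENNReal.ofReal (M + M), ENNReal.ofReal_ne_top, fun x y => iSup_le fun z => ?_⟩
  exact ENNReal.ofReal_le_ofReal
    ((abs_sub _ _).trans (add_le_add (hM _ (hC x z)) (hM _ (hC y z))))

theorem isPseudometricOn_pullbackGH (T : ∀ X : ALL S, TopologicalSpace X.carrier)
    {f : ℝ → ℝ} (hf : LBM f) : IsPseudometricOn (ALLIfd T) (pullbackGH f) where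
  toIsExtPseudometricOn := isExtPseudometricOn_pullbackGH f _
  finite := by
    rintro _ ⟨X, ⟨⟨x₀⟩, -, C, hC⟩, rfl⟩ _ ⟨Y, ⟨⟨y₀⟩, -, C', hC'⟩, rfl⟩
    obtain ⟨D, hD, hXD⟩ := X.dSup_bounded hf hC
    obtain ⟨D', hD', hYD⟩ := Y.dSup_bounded hf hC'
    have hR : IsCorrespondence (fun (_ : (X.Phi f).carrier) (_ : (Y.Phi f).carrier) => True) :=
      ⟨fun _ => ⟨y₀, trivial⟩, fun _ => ⟨x₀, trivial⟩⟩
    have hdist : distortion (fun (_ : (X.Phi f).carrier) (_ : (Y.Phi f).carrier) => True)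
        ≤ max D D' :=
      distortion_le fun a a' b b' _ _ =>
        max_le_max (tsub_le_self.trans (hXD a a')) (tsub_le_self.trans (hYD b b'))
    have hle : (X.Phi f).dGH (Y.Phi f) ≤ max D D' / 2 :=
      (EPM.dGH_le_of_correspondence hR).trans (ENNReal.div_le_div_right hdist 2)
    exact ne_top_of_le_ne_top (ENNReal.div_ne_top (max_lt hD.lt_top hD'.lt_top).ne two_ne_zero) hle

/-! ### Bipartite spaces -/

open Classical in
/-- The signed Lorentzian distance of a bipartite space with sources `P`, sinks `Q` and incidence
relation `M`: it is `1` from a source to an incident sink, `-1` in the opposite direction, and `0`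
for all other pairs. -/
noncomputable def bipartiteSigma {P Q : Type u} (M : P → Q → Prop) : P ⊕ Q → P ⊕ Q → ℝ
  | .inl p, .inr q => if M p q then 1 else 0
  | .inr q, .inl p => if M p q then -1 else 0
  | .inl _, .inl _ => 0
  | .inr _, .inr _ => 0

/-- The bipartite space with sources `P`, sinks `Q` and incidence relation `M`. -/
noncomputable def bipartite {P Q : Type u} (hcard : Cardinal.mk (P ⊕ Q) ≤ Cardinal.mk S)
    (M : P → Q → Prop) : ALL S where
  carrier := P ⊕ Q
  card_le := hcard
  σ := bipartiteSigma M
  antisymm := by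
    rintro (p | q) (p' | q') <;> simp only [bipartiteSigma] <;> (try split_ifs) <;> norm_num
  reverse_triangle := by
    -- A positive value goes from a source to a sink, so two of them are never consecutive.
    rintro (p | q) (p' | q') (p'' | q'') <;> simp only [bipartiteSigma] <;> (try split_ifs) <;> norm_num

/-- A relation is reduced if its rows and its columns are nonempty and pairwise distinct. -/
structure IsReduced {P Q : Type u} (M : P → Q → Prop) : Prop where
  row_nonempty : ∀ p, ∃ q, M p q
  col_nonempty : ∀ q, ∃ p, M p q
  row_separated : ∀ p p', p ≠ p' → ∃ q, ¬(M p q ↔ M p' q)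
  col_separated : ∀ q q', q ≠ q' → ∃ p, ¬(M p q ↔ M p q')

theorem dSup_bipartite_le {P Q : Type u} {hcard : Cardinal.mk (P ⊕ Q) ≤ Cardinal.mk S}
    {M M' : P → Q → Prop} (hM' : IsReduced M') (f : ℝ → ℝ) (x y : P ⊕ Q) :
    (bipartite hcard M).dSup f x y ≤ (bipartite hcard M').dSup f x y := by
  -- Nonzero terms on the left are `|f 1 - f 0|` or `|f (-1) - f 0|`; it suffices to find, for the
  -- same pair `x, y`, a point `w` where the same value is attained on the right.
  have key : ∀ z : P ⊕ Q,
      |f (bipartiteSigma M x z) - f (bipartiteSigma M y z)| = 0 ∨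
      ∃ w, |f (bipartiteSigma M x z) - f (bipartiteSigma M y z)| =
        |f (bipartiteSigma M' x w) - f (bipartiteSigma M' y w)| := by
    intro z
    rw [or_iff_not_imp_left]
    intro hz
    rcases x with p | q <;> rcases y with p' | q' <;> rcases z with a | b
    · simp [bipartiteSigma] at hz
    · obtain ⟨w, hw⟩ := hM'.row_separated p p' (by rintro rfl; simp at hz)
      refine ⟨.inr w, ?_⟩
      simp only [bipartiteSigma] at hz ⊢
      by_cases h1 : M p b <;> by_cases h2 : M p' b <;> by_cases h3 : M' p w <;>
        by_cases h4 : M' p' w <;> simp_all [abs_sub_comm]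
    · obtain ⟨w, hw⟩ := hM'.col_nonempty q'
      refine ⟨.inl w, ?_⟩
      simp only [bipartiteSigma] at hz ⊢
      by_cases h1 : M a q' <;> simp_all
    · obtain ⟨w, hw⟩ := hM'.row_nonempty p
      refine ⟨.inr w, ?_⟩
      simp only [bipartiteSigma] at hz ⊢
      by_cases h1 : M p b <;> simp_all
    · obtain ⟨w, hw⟩ := hM'.col_nonempty q
      refine ⟨.inl w, ?_⟩
      simp only [bipartiteSigma] at hz ⊢
      by_cases h1 : M a q <;> simp_all
    · obtain ⟨w, hw⟩ := hM'.row_nonempty p'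
      refine ⟨.inr w, ?_⟩
      simp only [bipartiteSigma] at hz ⊢
      by_cases h1 : M p' b <;> simp_all
    · obtain ⟨w, hw⟩ := hM'.col_separated q q' (by rintro rfl; simp at hz)
      refine ⟨.inl w, ?_⟩
      simp only [bipartiteSigma] at hz ⊢
      by_cases h1 : M a q <;> by_cases h2 : M a q' <;> by_cases h3 : M' w q <;>
        by_cases h4 : M' w q' <;> simp_all [abs_sub_comm]
    · simp [bipartiteSigma] at hz
  refine iSup_le fun z => ?_
  change ENNReal.ofReal |f (bipartiteSigma M x z) - f (bipartiteSigma M y z)| ≤ _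
  rcases key z with h | ⟨w, hw⟩
  · simp [h]
  · rw [hw]
    exact le_iSup (fun w : P ⊕ Q =>
      ENNReal.ofReal |f (bipartiteSigma M' x w) - f (bipartiteSigma M' y w)|) w

/-- The distance `dSup f` of a bipartite space with reduced incidence relation does not depend on
the relation. -/
theorem dSup_bipartite_congr {P Q : Type u} {hcard : Cardinal.mk (P ⊕ Q) ≤ Cardinal.mk S}
    {M M' : P → Q → Prop} (hM : IsReduced M) (hM' : IsReduced M') (f : ℝ → ℝ) (x y : P ⊕ Q) :
    (bipartite hcard M).dSup f x y = (bipartite hcard M').dSup f x y :=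
  le_antisymm (dSup_bipartite_le hM' f x y) (dSup_bipartite_le hM f x y)

theorem PhiI_bipartite_congr {P Q : Type u} {hcard : Cardinal.mk (P ⊕ Q) ≤ Cardinal.mk S}
    {M M' : P → Q → Prop} (hM : IsReduced M) (hM' : IsReduced M') (f : ℝ → ℝ) :
    PhiI f (bipartite hcard M).toClass = PhiI f (bipartite hcard M').toClass :=
  Quotient.sound (s := EPM.isoSetoid S)
    ⟨⟨Equiv.refl _, fun x y => (dSup_bipartite_congr hM hM' f x y).symm⟩⟩

theorem bipartiteSigma_pos_iff {P Q : Type u} {M : P → Q → Prop} {x y : P ⊕ Q} :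
    0 < bipartiteSigma M x y ↔ ∃ p q, x = .inl p ∧ y = .inr q ∧ M p q := by
  rcases x with p | q <;> rcases y with p' | q' <;> simp only [bipartiteSigma] <;>
    (try split_ifs) <;> simp_all

theorem bipartite_mem_ALLIfd (T : ∀ X : ALL S, TopologicalSpace X.carrier) {P Q : Type u}
    [Finite P] [Finite Q] [Nonempty P] {hcard : Cardinal.mk (P ⊕ Q) ≤ Cardinal.mk S}
    (M : P → Q → Prop) : (bipartite hcard M).toClass ∈ ALLIfd T := by
  refine ⟨bipartite hcard M, ⟨inferInstanceAs (Nonempty (P ⊕ Q)), ?_, 1, ?_⟩, rfl⟩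
  · have : Finite (bipartite hcard M).carrier := inferInstanceAs (Finite (P ⊕ Q))
    exact @Finite.compactSpace _ (T _) this
  · change ∀ x y : P ⊕ Q, |bipartiteSigma M x y| ≤ 1
    rintro (p | q) (p' | q') <;> simp only [bipartiteSigma] <;> (try split_ifs) <;> norm_num

/-! ### Failure of injectivity -/

/-- The identity and the triangular incidence relation on two sources and two sinks give
non-isomorphic spaces: only in the latter is some source incident to both sinks. -/
theorem toClass_bipartite_eq_ne {hcard : Cardinal.mk (ULift.{u} Bool ⊕ ULift.{u} Bool) ≤
    Cardinal.mk S} :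
    (bipartite hcard fun p q => p = q).toClass ≠
      (bipartite hcard fun p q => p.down ≤ q.down).toClass := by
  intro h
  obtain ⟨e⟩ := Quotient.exact (s := ALL.isoSetoid S) h.symm
  have hpos : ∀ q : Bool, ∃ p' q' : ULift.{u} Bool,
      e.toEquiv (Sum.inl ⟨false⟩) = Sum.inl p' ∧ e.toEquiv (Sum.inr ⟨q⟩) = Sum.inr q' ∧
        p' = q' := by
    intro q
    have hq : 0 < bipartiteSigma (fun p q : ULift.{u} Bool => p.down ≤ q.down)
        (Sum.inl ⟨false⟩) (Sum.inr ⟨q⟩) :=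
      bipartiteSigma_pos_iff.2 ⟨⟨false⟩, ⟨q⟩, rfl, rfl, Bool.false_le q⟩
    exact bipartiteSigma_pos_iff.1
      (hq.trans_eq (e.map_σ (Sum.inl ⟨false⟩) (Sum.inr ⟨q⟩)).symm)
  obtain ⟨p₁, q₁, hp₁, hq₁, rfl⟩ := hpos false
  obtain ⟨p₂, q₂, hp₂, hq₂, rfl⟩ := hpos true
  have hp : p₁ = p₂ := Sum.inl_injective (hp₁.symm.trans hp₂)
  subst hp
  have := Sum.inr_injective (e.toEquiv.injective (hq₁.trans hq₂.symm))
  simp at this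

theorem isReduced_eq {P : Type u} : IsReduced fun p q : P => p = q where
  row_nonempty p := ⟨p, rfl⟩
  col_nonempty p := ⟨p, rfl⟩
  row_separated p _ h := ⟨p, fun hiff => h (hiff.1 rfl).symm⟩
  col_separated p _ h := ⟨p, fun hiff => h (hiff.1 rfl)⟩

theorem isReduced_le {α : Type*} [PartialOrder α] :
    IsReduced fun p q : ULift.{u} α => p.down ≤ q.down where
  row_nonempty p := ⟨p, le_rfl⟩
  col_nonempty p := ⟨p, le_rfl⟩
  row_separated p p' h := by
    by_contra! hc
    exact h (ULift.ext _ _ (le_antisymm ((hc p').2 le_rfl) ((hc p).1 le_rfl)))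
  col_separated p p' h := by
    by_contra! hc
    exact h (ULift.ext _ _ (le_antisymm ((hc p).1 le_rfl) ((hc p').2 le_rfl)))

theorem exists_ne_PhiI_eq [Infinite S] (T : ∀ X : ALL S, TopologicalSpace X.carrier)
    (f : ℝ → ℝ) :
    ∃ x ∈ ALLIfd T, ∃ y ∈ ALLIfd T, PhiI f x = PhiI f y ∧ x ≠ y := by
  have hcard : Cardinal.mk (ULift.{u} Bool ⊕ ULift.{u} Bool) ≤ Cardinal.mk S :=
    Cardinal.mk_le_aleph0.trans (Cardinal.aleph0_le_mk S)
  exact ⟨_, bipartite_mem_ALLIfd T (hcard := hcard) _, _, bipartite_mem_ALLIfd T _,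
    PhiI_bipartite_congr isReduced_eq isReduced_le f, toClass_bipartite_eq_ne⟩

end LorentzGH

theorem mainTheorem11 (S : Type*)
    (T : ∀ X : LorentzGH.ALL S, TopologicalSpace X.carrier)
    (f : ℝ → ℝ) (hf : LorentzGH.LBM f) :
    LorentzGH.IsExtPseudometricOn (Set.univ : Set (LorentzGH.ALLI S)) (LorentzGH.pullbackGH f) ∧
    LorentzGH.IsPseudometricOn (LorentzGH.ALLIfd T) (LorentzGH.pullbackGH f) ∧
    (Infinite S →
      ¬ Set.InjOn (LorentzGH.PhiI f) (LorentzGH.ALLIfd T) ∧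
      ¬ LorentzGH.IsMetricOn (LorentzGH.ALLIfd T) (LorentzGH.pullbackGH f)) := by
  refine ⟨LorentzGH.isExtPseudometricOn_pullbackGH f _,
    LorentzGH.isPseudometricOn_pullbackGH T hf, fun hS => ?_⟩
  obtain ⟨x, hx, y, hy, hxy, hne⟩ := LorentzGH.exists_ne_PhiI_eq T f
  refine ⟨fun hinj => hne (hinj hx hy hxy), fun hmet => hne (hmet.eq_of_eq_zero x hx y hy ?_)⟩
  have h0 := hmet.self y hy
  unfold LorentzGH.pullbackGH at h0 ⊢
  rw [hxy, h0]
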